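/- Let $d\ge 1$, let $\mathcal X$ and $\mathcal Y$ be $d$-dimensional complex Hilbert spaces with linear operators $L(\mathcal X)$, $L(\mathcal Y)$, and let $|1\rangle,\dots,|d\rangle$ be an orthonormal basis of $\mathcal X$. A super-operator is a complex-linear map $\Phi:L(\mathcal X)\to L(\mathcal Y)$. It is trace-preserving if $\operatorname{Tr}\Phi(A)=\operatorname{Tr}A$ for all $A$, unital if $\Phi(\mathbb 1_{\mathcal X})=\mathbb 1_{\mathcal Y}$, and doubly stochastic if it is completely positive, trace-preserving and unital. It is mixed-unitary if there are finitely many unitary operators $U_1,\dots,U_N:\mathcal X\to\mathcal Y$ and a probability vector $(p_1,\dots,p_N)$ with $\Phi(A)=\sum_{i=1}^N p_i\,U_iAU_i^{*}$ for all $A\in L(\mathcal X)$. Its Choi–Jamiołkowski representation is $$J(\Phi)=\sum_{1\le i,j\le d}\Phi(|i\rangle\langle j|)\otimes|i\rangle\langle j|\in L(\mathcal Y\otimes\mathcal X).$$ The completely depolarizing channel is $\Omega(A)=\frac{\operatorname{Tr}(A)}{d}\mathbb 1_{\mathcal Y}$, and $\|\cdot\|_\infty$ denotes the operator (spectral) norm.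 1. Let $\Phi$ be a trace-preserving and unital super-operator such that $J(\Phi)$ is Hermitian and $$\Big\|J(\Phi)-\tfrac1d\mathbb 1_{\mathcal Y\otimes\mathcal X}\Big\|_\infty\le\frac{1}{d(d^2-1)}.$$ Then $\Phi$ is mixed-unitary. (For $d=1$ the left-hand side is always $0$ and the inequality is regarded as satisfied.) 2. Consequently, within the smallest real affine subspace $\mathcal A$ of super-operators that contains all doubly stochastic channels, there is a ball of positive radius around $\Omega$ consisting of mixed-unitary channels: $\Omega\in\mathcal A$, and there is $r>0$ such that every $\Phi\in\mathcal A$ with $\|J(\Phi)-J(\Omega)\|_\infty\le r$ is mixed-unitary. -/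

import Mathlib

open scoped TensorProduct CStarAlgebra

noncomputable section

namespace QChannel

variable {X Y : Type*} [NormedAddCommGroup X] [InnerProductSpace ℂ X] [CompleteSpace X]
  [NormedAddCommGroup Y] [InnerProductSpace ℂ Y] [CompleteSpace Y]

/-- Super-operators: complex-linear maps from the operators on `X` to the operators on `Y`. For
finite-dimensional spaces `X →L[ℂ] X` consists of all linear operators on `X`. -/
abbrev SuperOp (X Y : Type*) [NormedAddCommGroup X] [InnerProductSpace ℂ X]
    [NormedAddCommGroup Y] [InnerProductSpace ℂ Y] :=
  (X →L[ℂ] X) →ₗ[ℂ] (Y →L[ℂ] Y)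

/-- The trace of an operator. -/
def tr (A : X →L[ℂ] X) : ℂ := LinearMap.trace ℂ X (A : X →ₗ[ℂ] X)

def TracePreserving (Φ : SuperOp X Y) : Prop := ∀ A, tr (Φ A) = tr A

def Unital (Φ : SuperOp X Y) : Prop := Φ 1 = 1

/-- Complete positivity, in the sense of C⋆-algebras: applying `Φ` to all the entries of a positive
`k × k` matrix of operators gives a positive matrix of operators, for every `k`. -/
def CompletelyPositive (Φ : SuperOp X Y) : Prop :=
  ∃ F : (X →L[ℂ] X) →CP (Y →L[ℂ] Y), F.toLinearMap = Φ

/-- A doubly stochastic channel: completely positive, trace-preserving and unital. -/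
def DoublyStochastic (Φ : SuperOp X Y) : Prop :=
  CompletelyPositive Φ ∧ TracePreserving Φ ∧ Unital Φ

/-- A mixed-unitary channel: `Φ(A) = ∑ i, p i • U i A (U i)⋆` for finitely many unitary operators
`U i : X → Y` and a probability vector `p`. -/
def MixedUnitary (Φ : SuperOp X Y) : Prop :=
  ∃ (N : ℕ) (U : Fin N → (X ≃ₗᵢ[ℂ] Y)) (p : Fin N → ℝ),
    (∀ i, 0 ≤ p i) ∧ ∑ i, p i = 1 ∧
    ∀ A : X →L[ℂ] X, Φ A = ∑ i, (p i : ℂ) •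
      ((U i : X →L[ℂ] Y) ∘L A ∘L ContinuousLinearMap.adjoint (U i : X →L[ℂ] Y))

/-- The completely depolarizing channel `Ω(A) = (Tr A / d) 𝟙`, where `d` is the dimension. -/
def depolarizing (X Y : Type*) [NormedAddCommGroup X] [InnerProductSpace ℂ X]
    [NormedAddCommGroup Y] [InnerProductSpace ℂ Y] : SuperOp X Y where
  toFun A := (tr A / (Module.finrank ℂ X : ℂ)) • (1 : Y →L[ℂ] Y)
  map_add' A B := by simp [tr, add_div, add_smul]
  map_smul' c A := by simp [tr, mul_div_assoc, mul_smul]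

/-- The Choi–Jamiołkowski representation `J(Φ) = ∑ i j, Φ(|i⟩⟨j|) ⊗ |i⟩⟨j|` with respect to an
orthonormal basis of `X`. -/
def choi {d : ℕ} (b : OrthonormalBasis (Fin d) ℂ X) (Φ : SuperOp X Y) :
    (Y ⊗[ℂ] X) →L[ℂ] (Y ⊗[ℂ] X) :=
  ∑ i, ∑ j, TensorProduct.mapL (Φ (InnerProductSpace.rankOne ℂ (b i) (b j)))
    (InnerProductSpace.rankOne ℂ (b i) (b j))

end QChannel

end

/-
A super-operator commuting with all conjugations by unitaries is a combination of the identity and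
`Ω`, so its twirl over the unitary group is read off from two traces. Twirling the rank-one
super-operators of a basis gives, for every `Φ` that preserves the trace and the identity, the
reproducing formula
  `Φ(A) = ∫ (1 + (d² - 1) Tr (Ad_U⁻¹ ∘ (Φ - Ω))) U A U⋆ dU`,   where `Ad_U(A) = U A U⋆`,
over the normalized Haar measure. The weight has total mass `1`, and its trace term is the quadratic
form of `J(Φ) - J(Ω)` at a vector of squared norm `d`, so the weight is nonnegative as soon as
`d (d² - 1) ‖J(Φ) - J(Ω)‖ ≤ 1`. Then `Φ` lies in the closed convex hull of the unitary channels,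
and the convex hull of a compact set in finite dimension is already closed by Carathéodory.
-/

namespace QChannel

open MeasureTheory Set InnerProductSpace

section ConvexHull

theorem convexHull_eq_iUnion_image_stdSimplex {E : Type*} [AddCommGroup E] [Module ℝ E]
    [FiniteDimensional ℝ E] (s : Set E) :
    convexHull ℝ s = ⋃ k : Fin (Module.finrank ℝ E + 2),
      (fun q : (Fin k → ℝ) × (Fin k → E) => ∑ i, q.1 i • q.2 i) ''
        (stdSimplex ℝ (Fin k) ×ˢ univ.pi fun _ => s) := by
  refine Subset.antisymm (fun x hx => ?_) (iUnion_subset fun k => ?_)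
  · obtain ⟨ι, _, z, w, hz, hind, hw, hw1, rfl⟩ := eq_pos_convex_span_of_mem_convexHull hx
    have hcard : Fintype.card ι < Module.finrank ℝ E + 2 :=
      Nat.lt_succ_of_le <| hind.card_le_finrank_succ.trans <|
        Nat.add_le_add_right (Submodule.finrank_le _) 1
    let e := (Fintype.equivFin ι).symm
    refine mem_iUnion.2 ⟨⟨_, hcard⟩, (w ∘ e, z ∘ e),
      ⟨⟨fun i => (hw _).le, (e.sum_comp w).trans hw1⟩, fun i _ => hz (mem_range_self _)⟩, ?_⟩
    exact e.sum_comp fun i => w i • z i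
  · rintro _ ⟨⟨w, z⟩, ⟨hw, hz⟩, rfl⟩
    exact mem_convexHull_of_exists_fintype w z hw.1 hw.2 (fun i => hz i trivial) rfl

theorem isCompact_convexHull {E : Type*} [AddCommGroup E] [Module ℝ E] [TopologicalSpace E]
    [ContinuousAdd E] [ContinuousSMul ℝ E] [FiniteDimensional ℝ E] {s : Set E}
    (hs : IsCompact s) : IsCompact (convexHull ℝ s) := by
  rw [convexHull_eq_iUnion_image_stdSimplex]
  exact isCompact_iUnion fun k =>
    ((isCompact_stdSimplex ℝ (Fin k)).prod (isCompact_univ_pi fun _ => hs)).image (by fun_prop)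

theorem integrable_of_continuous {T E : Type*} [TopologicalSpace T] [CompactSpace T]
    [MeasurableSpace T] [OpensMeasurableSpace T] [NormedAddCommGroup E] {f : T → E}
    (hf : Continuous f) (μ : Measure T) [IsFiniteMeasure μ] : Integrable f μ :=
  hf.integrable_of_hasCompactSupport (HasCompactSupport.of_compactSpace _)

theorem integral_smul_mem_convexHull_range {T E : Type*} [TopologicalSpace T] [CompactSpace T]
    [MeasurableSpace T] [BorelSpace T] [NormedAddCommGroup E] [NormedSpace ℝ E]
    [FiniteDimensional ℝ E] (μ : Measure T) [IsFiniteMeasure μ] {f : T → E} (hf : Continuous f)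
    {w : T → ℝ} (hw : Continuous w) (hw0 : ∀ t, 0 ≤ w t) (hw1 : ∫ t, w t ∂μ = 1) :
    ∫ t, w t • f t ∂μ ∈ convexHull ℝ (range f) := by
  have : CompleteSpace E := FiniteDimensional.complete ℝ E
  let ν := μ.withDensity fun t => ENNReal.ofReal (w t)
  have hwint : Integrable w μ := integrable_of_continuous hw μ
  have : IsProbabilityMeasure ν := ⟨by
    rw [withDensity_apply _ MeasurableSet.univ, Measure.restrict_univ,
      ← ofReal_integral_eq_lintegral_ofReal hwint (.of_forall hw0), hw1, ENNReal.ofReal_one]⟩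
  have hν : ∫ t, f t ∂ν = ∫ t, w t • f t ∂μ := by
    rw [integral_withDensity_eq_integral_toReal_smul (by fun_prop) (by simp)]
    simp [ENNReal.toReal_ofReal (hw0 _)]
  rw [← hν]
  exact (convex_convexHull ℝ _).integral_mem (isCompact_convexHull (isCompact_range hf)).isClosed
    (.of_forall fun t => subset_convexHull ℝ _ (mem_range_self t))
    (integrable_of_continuous hf ν)

end ConvexHull

section Twirl

variable {G A : Type*} [Group G] [NormedRing A]

/-- Conjugation by the values of a homomorphism `ρ`, as a homomorphism into the bounded operators:
`conjRep 𝕜 ρ g` sends `x` to `ρ g * x * ρ g⁻¹`. -/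
noncomputable def conjRep (𝕜 : Type*) [NontriviallyNormedField 𝕜] [NormedAlgebra 𝕜 A]
    (ρ : G →* A) : G →* (A →L[𝕜] A) where
  toFun g := ContinuousLinearMap.mulLeftRight 𝕜 A (ρ g) (ρ g⁻¹)
  map_one' := by ext; simp
  map_mul' g h := by ext; simp [mul_assoc]

theorem continuous_conjRep [TopologicalSpace G] [ContinuousInv G] {𝕜 : Type*}
    [NontriviallyNormedField 𝕜] [NormedAlgebra 𝕜 A] {ρ : G →* A} (hρ : Continuous ρ) :
    Continuous (conjRep 𝕜 ρ) := by
  change Continuous fun g => ContinuousLinearMap.mulLeftRight 𝕜 A (ρ g) (ρ g⁻¹)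
  fun_prop

/-- The twirl of `R`: the average of its conjugates by the values of `ρ`. -/
noncomputable def twirl [NormedAlgebra ℝ A] [MeasurableSpace G] (μ : Measure G) (ρ : G →* A)
    (R : A) : A :=
  ∫ g, ρ g * R * ρ g⁻¹ ∂μ

variable [NormedAlgebra ℝ A] [TopologicalSpace G] [IsTopologicalGroup G] [CompactSpace G]
  [MeasurableSpace G] [BorelSpace G]

theorem commute_twirl (μ : Measure G) [IsFiniteMeasure μ] [μ.IsMulLeftInvariant] {ρ : G →* A}
    (hρ : Continuous ρ) (h : G) (R : A) : Commute (ρ h) (twirl μ ρ R) := by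
  have hint : Integrable (fun g => ρ g * R * ρ g⁻¹) μ := integrable_of_continuous (by fun_prop) μ
  have hinv : twirl μ ρ R = ∫ g, ρ h * (ρ g * R * ρ g⁻¹) * ρ h⁻¹ ∂μ := by
    rw [twirl, ← integral_mul_left_eq_self _ h]
    simp only [map_mul, mul_inv_rev, mul_assoc]
  calc ρ h * twirl μ ρ R
      = ∫ g, ρ h * (ρ g * R * ρ g⁻¹) ∂μ := (integral_const_mul_of_integrable hint).symm
    _ = (∫ g, ρ h * (ρ g * R * ρ g⁻¹) * ρ h⁻¹ ∂μ) * ρ h := by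
      rw [← integral_mul_const_of_integrable (integrable_of_continuous (by fun_prop) μ)]
      simp only [mul_assoc, ← map_mul, inv_mul_cancel, mul_one]
    _ = twirl μ ρ R * ρ h := by rw [← hinv]

theorem map_twirl [CompleteSpace A] {E : Type*} [NormedAddCommGroup E] [NormedSpace ℝ E]
    [CompleteSpace E] (μ : Measure G) [IsProbabilityMeasure μ] {ρ : G →* A} (hρ : Continuous ρ)
    (φ : A →L[ℝ] E) {R : A} (hφ : ∀ g, φ (ρ g * R * ρ g⁻¹) = φ R) : φ (twirl μ ρ R) = φ R := by
  rw [twirl, ← φ.integral_comp_comm (integrable_of_continuous (by fun_prop) μ)]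
  simp [hφ]

end Twirl

section Trace

theorem trace_eq_sum_of_sum_smul {R M ι : Type*} [CommRing R] [AddCommGroup M] [Module R M]
    [Module.Free R M] [Module.Finite R M] [Fintype ι] {e : ι → M} {l : ι → M →ₗ[R] R}
    (h : ∀ v, ∑ i, l i v • e i = v) (f : M →ₗ[R] M) :
    LinearMap.trace R M f = ∑ i, l i (f (e i)) := by
  have hf : f = ∑ i, (l i).smulRight (f (e i)) := by
    ext v
    conv_lhs => rw [← h v]
    simp
  conv_lhs => rw [hf]
  simp [LinearMap.trace_smulRight]

/-- The trace of operators as a continuous linear functional. It is used both for operators on a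
Hilbert space, where it agrees with `tr`, and for super-operators. -/
noncomputable def opTrace (V : Type*) [NormedAddCommGroup V] [NormedSpace ℂ V]
    [FiniteDimensional ℂ V] : (V →L[ℂ] V) →L[ℂ] ℂ :=
  LinearMap.toContinuousLinearMap (LinearMap.trace ℂ V ∘ₗ ContinuousLinearMap.coeLM ℂ)

variable {V : Type*} [NormedAddCommGroup V] [NormedSpace ℂ V] [FiniteDimensional ℂ V]

theorem opTrace_apply (f : V →L[ℂ] V) : opTrace V f = LinearMap.trace ℂ V f := rfl

theorem opTrace_mul_comm (f g : V →L[ℂ] V) : opTrace V (f * g) = opTrace V (g * f) :=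
  LinearMap.trace_mul_comm ℂ (f : V →ₗ[ℂ] V) g

theorem opTrace_one : opTrace V 1 = Module.finrank ℂ V := LinearMap.trace_one ℂ V

theorem opTrace_smulRight (l : V →L[ℂ] ℂ) (v : V) : opTrace V (l.smulRight v) = l v :=
  LinearMap.trace_smulRight (l : V →ₗ[ℂ] ℂ) v

variable {H : Type*} [NormedAddCommGroup H] [InnerProductSpace ℂ H] [FiniteDimensional ℂ H]

theorem opTrace_rankOne (x y : H) : opTrace H (rankOne ℂ x y) = inner ℂ y x := trace_rankOne x y

theorem tr_eq_opTrace (A : H →L[ℂ] H) : tr A = opTrace H A := rfl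

theorem finrank_continuousLinearMap_self :
    Module.finrank ℂ (V →L[ℂ] V) = Module.finrank ℂ V ^ 2 := by
  rw [← (LinearMap.toContinuousLinearMap (𝕜 := ℂ) (E := V) (F' := V)).finrank_eq,
    Module.finrank_linearMap, sq]

end Trace

section Commutant

theorem exists_forall_mem_eq_smul {K V : Type*} [Field K] [AddCommGroup V] [Module K V]
    {f : V →ₗ[K] V} {W : Submodule K V} (hf : ∀ v ∈ W, ∃ c : K, f v = c • v) :
    ∃ c : K, ∀ v ∈ W, f v = c • v := by
  have hW : ∀ v ∈ W, f v ∈ W := fun v hv => by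
    obtain ⟨c, hc⟩ := hf v hv
    simpa [hc] using W.smul_mem c hv
  obtain ⟨c, hc⟩ := LinearMap.exists_eq_smul_id_of_forall_notLinearIndependent
    (f := f.restrict hW) fun v hv => by
      obtain ⟨c, hc⟩ := hf v v.2
      rw [LinearIndependent.pair_iff] at hv
      simpa using hv c (-1) (by ext; simp [hc])
  exact ⟨c, fun v hv => by simpa using congr(($(LinearMap.congr_fun hc ⟨v, hv⟩) : V))⟩

variable {H : Type*} [NormedAddCommGroup H] [InnerProductSpace ℂ H] [CompleteSpace H]

/-- The reflection in the line through `y` as a unitary. -/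
noncomputable def lineReflection (y : H) : unitary (H →L[ℂ] H) :=
  Unitary.linearIsometryEquiv.symm (ℂ ∙ y).reflection

theorem coe_lineReflection (y : H) :
    (lineReflection y : H →L[ℂ] H) = (2 : ℂ) • (ℂ ∙ y).starProjection - 1 :=
  ContinuousLinearMap.ext fun x =>
    (Submodule.reflection_apply x).trans (by simp [two_smul])

theorem lineReflection_apply_eq_self_iff {x y : H} :
    (lineReflection y : H →L[ℂ] H) x = x ↔ ∃ c : ℂ, x = c • y := by
  refine Submodule.reflection_eq_self_iff x |>.trans ?_
  simp only [Submodule.mem_span_singleton, eq_comm]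

theorem exists_apply_eq_smul_of_commute_lineReflection {B : H →L[ℂ] H} {y : H}
    (hB : Commute (lineReflection y : H →L[ℂ] H) B) : ∃ c : ℂ, B y = c • y := by
  have hy : (lineReflection y : H →L[ℂ] H) y = y :=
    lineReflection_apply_eq_self_iff.2 ⟨1, (one_smul ℂ y).symm⟩
  refine lineReflection_apply_eq_self_iff.1 ?_
  rw [← mul_apply_eq_comp, hB.eq, mul_apply_eq_comp, hy]

theorem commute_lineReflection_starProjection {K : Submodule ℂ H} [K.HasOrthogonalProjection]
    {y : H} (hy : y ∈ K ∨ y ∈ Kᗮ) : Commute (lineReflection y : H →L[ℂ] H) K.starProjection := by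
  rw [coe_lineReflection]
  refine (Commute.smul_left ?_ _).sub_left (Commute.one_left _)
  rcases hy with hy | hy
  · have hle : ℂ ∙ y ≤ K := (Submodule.span_singleton_le_iff_mem _ _).2 hy
    refine (Submodule.starProjection_comp_starProjection_of_le hle).trans ?_
    ext x
    exact (Submodule.starProjection_eq_self_iff.2
      (hle ((ℂ ∙ y).starProjection_apply_mem x))).symm
  · have hperp : ℂ ∙ y ⟂ K := (Submodule.span_singleton_le_iff_mem _ _).2 hy
    exact hperp.starProjection_comp_starProjection.trans
      hperp.symm.starProjection_comp_starProjection.symm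

theorem exists_eq_smul_one_add_smul_starProjection {K : Submodule ℂ H}
    [K.HasOrthogonalProjection] {B : H →L[ℂ] H}
    (hB : ∀ u : unitary (H →L[ℂ] H), Commute (u : H →L[ℂ] H) K.starProjection →
      Commute (u : H →L[ℂ] H) B) :
    ∃ β γ : ℂ, B = β • 1 + γ • K.starProjection := by
  -- Every vector of `K` and of `Kᗮ` is an eigenvector of `B`, since the reflection in its line
  -- commutes with the projection.
  have hscalar : ∀ W : Submodule ℂ H, (∀ y ∈ W, y ∈ K ∨ y ∈ Kᗮ) →
      ∃ c : ℂ, ∀ y ∈ W, B y = c • y := fun W hW =>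
    exists_forall_mem_eq_smul (f := (B : H →ₗ[ℂ] H)) fun y hy =>
      exists_apply_eq_smul_of_commute_lineReflection
        (hB _ (commute_lineReflection_starProjection (hW y hy)))
  obtain ⟨α, hα⟩ := hscalar K fun _ => .inl
  obtain ⟨β, hβ⟩ := hscalar Kᗮ fun _ => .inr
  refine ⟨β, α - β, ContinuousLinearMap.ext fun v => ?_⟩
  have hv := hβ _ (K.sub_starProjection_mem_orthogonal v)
  rw [map_sub, hα _ (K.starProjection_apply_mem v), sub_eq_iff_eq_add] at hv
  rw [hv, add_apply, smul_apply, smul_apply, one_apply_eq_self]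
  module

end Commutant

section Covariant

variable {H : Type*} [NormedAddCommGroup H] [InnerProductSpace ℂ H]

theorem sum_rankOne_apply_self {ι : Type*} [Fintype ι] (b : OrthonormalBasis ι ℂ H)
    (A : H →L[ℂ] H) : ∑ i, rankOne ℂ (A (b i)) (b i) = A := by
  simp only [← comp_rankOne, ← ContinuousLinearMap.comp_finsetSum,
    b.sum_rankOne_eq_id, ContinuousLinearMap.comp_id]

theorem two_smul_rankOne (x y : H) :
    (2 : ℂ) • (rankOne ℂ x y : H →L[ℂ] H) =
      rankOne ℂ (x + y) (x + y) + Complex.I • rankOne ℂ (x + Complex.I • y) (x + Complex.I • y) -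
        (1 + Complex.I) • (rankOne ℂ x x + rankOne ℂ y y) := by
  ext z
  simp only [rankOne_apply, add_apply, sub_apply, smul_apply, inner_add_left, inner_smul_left,
    Complex.conj_I]
  linear_combination (norm := module) Complex.I_sq •
    (inner ℂ y z • x - (inner ℂ x z - Complex.I * inner ℂ y z) • y)

theorem linearMap_ext_rankOne_self [FiniteDimensional ℂ H] {V : Type*} [AddCommGroup V]
    [Module ℂ V] {f g : (H →L[ℂ] H) →ₗ[ℂ] V}
    (hfg : ∀ v : H, ‖v‖ = 1 → f (rankOne ℂ v v) = g (rankOne ℂ v v)) : f = g := by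
  have hself : ∀ v : H, (f - g) (rankOne ℂ v v) = 0 := fun v => by
    rcases eq_or_ne v 0 with rfl | hv
    · simp
    have hv' : (‖v‖ : ℂ) ≠ 0 := by simpa using hv
    have h := hfg ((‖v‖ : ℂ)⁻¹ • v) (by simp [norm_smul, hv])
    simpa [hv', sub_eq_zero] using h
  have hcross : ∀ x y : H, (f - g) (rankOne ℂ x y) = 0 := fun x y => by
    refine (smul_eq_zero_iff_right (two_ne_zero' ℂ)).1 ?_
    rw [← map_smul, two_smul_rankOne]
    simp only [map_sub (f - g), map_add (f - g), map_smul (f - g), hself, smul_zero,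
      add_zero, sub_zero]
  refine sub_eq_zero.1 (LinearMap.ext fun A => ?_)
  rw [← sum_rankOne_apply_self (stdOrthonormalBasis ℂ H) A, map_sum]
  simp only [hcross, Finset.sum_const_zero, LinearMap.zero_apply]

theorem exists_unitary_apply_eq [CompleteSpace H] [FiniteDimensional ℂ H] {x y : H}
    (hx : ‖x‖ = 1) (hy : ‖y‖ = 1) : ∃ u : unitary (H →L[ℂ] H), (u : H →L[ℂ] H) x = y := by
  have : Nontrivial H := ⟨x, 0, by rintro rfl; simp at hx⟩
  let i : Fin (Module.finrank ℂ H) := ⟨0, Module.finrank_pos⟩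
  have exists_basis : ∀ z : H, ‖z‖ = 1 →
      ∃ b : OrthonormalBasis (Fin (Module.finrank ℂ H)) ℂ H, b i = z := fun z hz => by
    obtain ⟨b, hb⟩ := Orthonormal.exists_orthonormalBasis_extension_of_card_eq (𝕜 := ℂ)
      (E := H) (by simp) (v := fun _ => z) (s := {i})
      ⟨fun _ => hz, fun j k hjk => absurd (Subsingleton.elim j k) hjk⟩
    exact ⟨b, hb i rfl⟩
  obtain ⟨b, rfl⟩ := exists_basis x hx
  obtain ⟨c, rfl⟩ := exists_basis y hy
  exact ⟨Unitary.linearIsometryEquiv.symm (b.equiv c (Equiv.refl _)), by simp⟩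

variable [CompleteSpace H]

/-- The conjugation super-operators `A ↦ u A u⋆` of the unitaries `u` of a Hilbert space. -/
noncomputable def unitaryConj (H : Type*) [NormedAddCommGroup H] [InnerProductSpace ℂ H]
    [CompleteSpace H] : unitary (H →L[ℂ] H) →* ((H →L[ℂ] H) →L[ℂ] (H →L[ℂ] H)) :=
  conjRep ℂ (unitary (H →L[ℂ] H)).subtype

theorem unitaryConj_apply (u : unitary (H →L[ℂ] H)) (A : H →L[ℂ] H) :
    unitaryConj H u A = u * A * star (u : H →L[ℂ] H) := rfl

theorem continuous_unitaryConj : Continuous (unitaryConj H) :=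
  continuous_conjRep continuous_subtype_val

theorem unitaryConj_rankOne (u : unitary (H →L[ℂ] H)) (x y : H) :
    unitaryConj H u (rankOne ℂ x y) =
      rankOne ℂ ((u : H →L[ℂ] H) x) ((u : H →L[ℂ] H) y) := by
  ext z
  simp [unitaryConj_apply, ContinuousLinearMap.star_eq_adjoint,
    ContinuousLinearMap.adjoint_inner_right]

theorem unitaryConj_one (u : unitary (H →L[ℂ] H)) : unitaryConj H u 1 = 1 := by
  simp [unitaryConj_apply]

theorem unitaryConj_eq_self_iff {u : unitary (H →L[ℂ] H)} {A : H →L[ℂ] H} :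
    unitaryConj H u A = A ↔ Commute (u : H →L[ℂ] H) A :=
  (Unitary.toUnits u).mul_inv_eq_iff_eq_mul

theorem depolarizing_apply {X Y : Type*} [NormedAddCommGroup X] [InnerProductSpace ℂ X]
    [NormedAddCommGroup Y] [InnerProductSpace ℂ Y] (A : X →L[ℂ] X) :
    depolarizing X Y A = (tr A / Module.finrank ℂ X) • (1 : Y →L[ℂ] Y) := rfl

variable [FiniteDimensional ℂ H]

theorem exists_eq_smul_add_smul_depolarizing {R : (H →L[ℂ] H) →L[ℂ] (H →L[ℂ] H)}
    (hR : ∀ u, Commute (unitaryConj H u) R) :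
    ∃ α γ : ℂ, (R : (H →L[ℂ] H) →ₗ[ℂ] (H →L[ℂ] H)) =
      α • LinearMap.id + γ • depolarizing H H := by
  rcases subsingleton_or_nontrivial H with hH | hH
  · exact ⟨0, 0, Subsingleton.elim _ _⟩
  have hcov : ∀ u A, R (unitaryConj H u A) = unitaryConj H u (R A) := fun u A =>
    congr($((hR u).eq.symm) A)
  have hd : (Module.finrank ℂ H : ℂ) ≠ 0 := by exact_mod_cast Module.finrank_pos.ne'
  obtain ⟨x₀, hx₀⟩ := exists_norm_eq H zero_le_one
  have hP : (ℂ ∙ x₀).starProjection = rankOne ℂ x₀ x₀ :=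
    ContinuousLinearMap.ext fun _ => Submodule.starProjection_unit_singleton ℂ hx₀ _
  obtain ⟨β, α, h₀⟩ := exists_eq_smul_one_add_smul_starProjection (K := ℂ ∙ x₀)
    (B := R (rankOne ℂ x₀ x₀)) fun u hu => by
      rw [hP, ← unitaryConj_eq_self_iff] at hu
      rw [← unitaryConj_eq_self_iff, ← hcov, hu]
  -- Unitaries act transitively on unit vectors, so `R` is determined by its value at `|x₀⟩⟨x₀|`.
  refine ⟨α, β * Module.finrank ℂ H, linearMap_ext_rankOne_self fun x hx => ?_⟩
  obtain ⟨u, rfl⟩ := exists_unitary_apply_eq hx₀ hx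
  rw [← unitaryConj_rankOne]
  have hR : R (unitaryConj H u (rankOne ℂ x₀ x₀)) =
      β • 1 + α • unitaryConj H u (rankOne ℂ x₀ x₀) := by
    rw [hcov, h₀, hP, map_add, map_smul, map_smul, unitaryConj_one]
  have hΩ : depolarizing H H (unitaryConj H u (rankOne ℂ x₀ x₀)) =
      (Module.finrank ℂ H : ℂ)⁻¹ • (1 : H →L[ℂ] H) := by
    rw [unitaryConj_rankOne, depolarizing_apply, tr_eq_opTrace, opTrace_rankOne,
      inner_self_eq_norm_sq_to_K, hx]
    simp
  simp [hR, hΩ, smul_smul, hd, add_comm]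

end Covariant

section UnitaryTwirl

variable {H : Type*} [NormedAddCommGroup H] [InnerProductSpace ℂ H] [FiniteDimensional ℂ H]

instance compactSpace_unitary [CompleteSpace H] : CompactSpace (unitary (H →L[ℂ] H)) := by
  have : ProperSpace (H →L[ℂ] H) := FiniteDimensional.proper ℂ _
  refine isCompact_iff_compactSpace.1 (Metric.isCompact_of_isClosed_isBounded isClosed_unitary ?_)
  refine isBounded_iff_forall_norm_le.2 ⟨1, fun u hu => ?_⟩
  exact ContinuousLinearMap.opNorm_le_bound _ zero_le_one fun x => by
    simp [ContinuousLinearMap.norm_map_of_mem_unitary hu]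

theorem opTrace_conj {G : Type*} [Group G] {V : Type*} [NormedAddCommGroup V] [NormedSpace ℂ V]
    [FiniteDimensional ℂ V] (ρ : G →* (V →L[ℂ] V)) (g : G) (R : V →L[ℂ] V) :
    opTrace V (ρ g * R * ρ g⁻¹) = opTrace V R := by
  rw [opTrace_mul_comm, ← mul_assoc, ← map_mul, inv_mul_cancel, map_one, one_mul]

section Depolarizing

variable {X Y : Type*} [NormedAddCommGroup X] [InnerProductSpace ℂ X] [FiniteDimensional ℂ X]
  [NormedAddCommGroup Y] [InnerProductSpace ℂ Y]

theorem depolarizing_eq_smulRight : depolarizing X Y =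
    (Module.finrank ℂ X : ℂ)⁻¹ • (opTrace X : (X →L[ℂ] X) →ₗ[ℂ] ℂ).smulRight 1 :=
  LinearMap.ext fun A => by
    simp [depolarizing_apply, div_eq_inv_mul, mul_smul, tr_eq_opTrace]

variable [FiniteDimensional ℂ Y] (h : Module.finrank ℂ X = Module.finrank ℂ Y)
include h

theorem unital_depolarizing : Unital (depolarizing X Y) := by
  rcases subsingleton_or_nontrivial Y with hY | hY
  · exact Subsingleton.elim _ _
  · have hd : (Module.finrank ℂ X : ℂ) ≠ 0 := by rw [h]; exact_mod_cast Module.finrank_pos.ne'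
    rw [Unital, depolarizing_apply, tr_eq_opTrace, opTrace_one, div_self hd, one_smul]

theorem tracePreserving_depolarizing : TracePreserving (depolarizing X Y) := fun A => by
  rcases subsingleton_or_nontrivial X with hX | hX
  · simp [Subsingleton.elim A 0, tr]
  · have hd : (Module.finrank ℂ X : ℂ) ≠ 0 := by exact_mod_cast Module.finrank_pos.ne'
    rw [depolarizing_apply, tr_eq_opTrace, map_smul, opTrace_one, ← h, smul_eq_mul,
      div_mul_cancel₀ _ hd]

theorem sub_depolarizing_one {Φ : SuperOp X Y} (hone : Unital Φ) :
    (Φ - depolarizing X Y) 1 = 0 := by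
  rw [LinearMap.sub_apply, hone, unital_depolarizing h, sub_self]

theorem tr_sub_depolarizing {Φ : SuperOp X Y} (htr : TracePreserving Φ) (A : X →L[ℂ] X) :
    tr ((Φ - depolarizing X Y) A) = 0 := by
  rw [LinearMap.sub_apply, tr_eq_opTrace, map_sub, ← tr_eq_opTrace, ← tr_eq_opTrace, htr,
    tracePreserving_depolarizing h, sub_self]

end Depolarizing

variable [CompleteSpace H] [MeasurableSpace (unitary (H →L[ℂ] H))]
  [BorelSpace (unitary (H →L[ℂ] H))] (μ : Measure (unitary (H →L[ℂ] H))) [IsProbabilityMeasure μ]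
  [μ.IsMulLeftInvariant]

theorem twirl_unitary_eq_depolarizing (A : H →L[ℂ] H) :
    twirl μ (unitary (H →L[ℂ] H)).subtype A = depolarizing H H A := by
  rcases subsingleton_or_nontrivial H with hH | hH
  · exact Subsingleton.elim _ _
  have hρ : Continuous (unitary (H →L[ℂ] H)).subtype := continuous_subtype_val
  obtain ⟨β, γ, hβ⟩ := exists_eq_smul_one_add_smul_starProjection (K := ⊥)
    fun u _ => commute_twirl μ hρ u A
  have htr : opTrace H (twirl μ (unitary (H →L[ℂ] H)).subtype A) = opTrace H A :=
    map_twirl μ hρ ((opTrace H).restrictScalars ℝ) fun u => opTrace_conj _ u A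
  have hd : (Module.finrank ℂ H : ℂ) ≠ 0 := by exact_mod_cast Module.finrank_pos.ne'
  rw [Submodule.starProjection_bot, smul_zero, add_zero] at hβ
  rw [hβ, map_smul, opTrace_one, smul_eq_mul, ← eq_div_iff hd] at htr
  rw [hβ, htr, depolarizing_apply, tr_eq_opTrace]

theorem smul_twirl_unitaryConj_apply (R : (H →L[ℂ] H) →L[ℂ] (H →L[ℂ] H)) (A : H →L[ℂ] H) :
    ((Module.finrank ℂ H : ℂ) ^ 2 - 1) • twirl μ (unitaryConj H) R A =
      (opTrace _ R - tr (R 1) / Module.finrank ℂ H) • A +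
        (Module.finrank ℂ H * tr (R 1) - opTrace _ R) • depolarizing H H A := by
  rcases subsingleton_or_nontrivial H with hH | hH
  · exact Subsingleton.elim _ _
  have hd : (Module.finrank ℂ H : ℂ) ≠ 0 := by exact_mod_cast Module.finrank_pos.ne'
  set T := twirl μ (unitaryConj H) R
  obtain ⟨α, γ, hT⟩ := exists_eq_smul_add_smul_depolarizing (R := T)
    fun u => commute_twirl μ continuous_unitaryConj u R
  have htrace : opTrace _ T = opTrace _ R :=
    map_twirl μ continuous_unitaryConj ((opTrace _).restrictScalars ℝ)
      fun u => opTrace_conj _ u R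
  have htrace_one : tr (T 1) = tr (R 1) :=
    map_twirl μ continuous_unitaryConj
      ((opTrace H ∘L ContinuousLinearMap.apply ℂ (H →L[ℂ] H) 1).restrictScalars ℝ) fun u => by
        change opTrace H (unitaryConj H u (R (unitaryConj H u⁻¹ 1))) = opTrace H (R 1)
        rw [unitaryConj_one]
        exact opTrace_conj (unitary (H →L[ℂ] H)).subtype u (R 1)
  have hTA : T A = α • A + γ • depolarizing H H A := congr($hT A)
  have hα : α * (Module.finrank ℂ H : ℂ) ^ 2 + γ = opTrace _ R := by
    rw [← htrace, opTrace_apply, hT, depolarizing_eq_smulRight]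
    simp [LinearMap.trace_smulRight, opTrace_one, finrank_continuousLinearMap_self, hd]
  have hγ : (α + γ) * (Module.finrank ℂ H : ℂ) = tr (R 1) := by
    rw [← htrace_one, show T 1 = α • 1 + γ • depolarizing H H 1 from congr($hT 1),
      unital_depolarizing rfl, ← add_smul, tr_eq_opTrace, map_smul, opTrace_one, smul_eq_mul]
  rw [hTA, ← hα, ← hγ, mul_div_cancel_right₀ _ hd]
  module

end UnitaryTwirl

section Reproducing

theorem integral_opTrace_smul_apply {G V ι : Type*} [Group G] [TopologicalSpace G]
    [IsTopologicalGroup G] [CompactSpace G] [MeasurableSpace G] [BorelSpace G] (μ : Measure G)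
    [IsFiniteMeasure μ] [NormedAddCommGroup V] [NormedSpace ℂ V] [FiniteDimensional ℂ V]
    {ρ : G →* (V →L[ℂ] V)} (hρ : Continuous ρ) [Fintype ι] {e : ι → V} {l : ι → V →L[ℂ] ℂ}
    (hel : ∀ v, ∑ i, l i v • e i = v) (R : V →L[ℂ] V) (v : V) :
    ∫ g, opTrace V (ρ g⁻¹ * R) • ρ g v ∂μ = ∑ i, twirl μ ρ ((l i).smulRight v) (R (e i)) := by
  have : CompleteSpace V := FiniteDimensional.complete ℂ V
  have hint : ∀ i, Integrable (fun g => ρ g * (l i).smulRight v * ρ g⁻¹) μ := fun i =>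
    integrable_of_continuous (by fun_prop) μ
  have hexpand : ∀ g, opTrace V (ρ g⁻¹ * R) • ρ g v =
      ∑ i, (ρ g * (l i).smulRight v * ρ g⁻¹) (R (e i)) := fun g => by
    rw [opTrace_apply, trace_eq_sum_of_sum_smul (l := fun i => (l i : V →ₗ[ℂ] ℂ)) hel,
      Finset.sum_smul]
    simp
  simp only [hexpand, twirl, ContinuousLinearMap.integral_apply (hint _)]
  exact integral_finsetSum _ fun i _ => (hint i).apply_continuousLinearMap _

variable {H : Type*} [NormedAddCommGroup H] [InnerProductSpace ℂ H] [FiniteDimensional ℂ H]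
  [CompleteSpace H] [MeasurableSpace (unitary (H →L[ℂ] H))]
  [BorelSpace (unitary (H →L[ℂ] H))] (μ : Measure (unitary (H →L[ℂ] H))) [IsProbabilityMeasure μ]
  [μ.IsMulLeftInvariant]

theorem smul_integral_opTrace_smul_unitaryConj {Δ : (H →L[ℂ] H) →L[ℂ] (H →L[ℂ] H)}
    (hone : Δ 1 = 0) (htr : ∀ A, tr (Δ A) = 0) (A : H →L[ℂ] H) :
    ((Module.finrank ℂ H : ℂ) ^ 2 - 1) •
      ∫ u, opTrace _ (unitaryConj H u⁻¹ * Δ) • unitaryConj H u A ∂μ = Δ A := by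
  let e := Module.finBasis ℂ (H →L[ℂ] H)
  let l := fun i => LinearMap.toContinuousLinearMap (e.coord i)
  have hel : ∀ B, ∑ i, l i B • e i = B := e.sum_repr
  have hΩ : ∀ B, depolarizing H H (Δ B) = 0 := fun B => by
    rw [depolarizing_apply, htr, zero_div, zero_smul]
  have hΔ : ∀ B, ∑ i, l i B • Δ (e i) = Δ B := fun B => by
    conv_rhs => rw [← hel B, map_sum]
    simp only [map_smul]
  rw [integral_opTrace_smul_apply μ continuous_unitaryConj hel, Finset.smul_sum]
  calc ∑ i, ((Module.finrank ℂ H : ℂ) ^ 2 - 1) •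
        twirl μ (unitaryConj H) ((l i).smulRight A) (Δ (e i))
      = ∑ i, (l i A • Δ (e i) - (tr A / Module.finrank ℂ H) • l i 1 • Δ (e i)) := by
        refine Finset.sum_congr rfl fun i _ => ?_
        rw [smul_twirl_unitaryConj_apply, hΩ, smul_zero, add_zero, opTrace_smulRight,
          ContinuousLinearMap.smulRight_apply, tr_eq_opTrace, tr_eq_opTrace, map_smul, smul_eq_mul]
        module
    _ = Δ A := by
        rw [Finset.sum_sub_distrib, ← Finset.smul_sum, hΔ, hΔ, hone, smul_zero, sub_zero]

theorem smul_integral_opTrace_unitaryConj {Δ : (H →L[ℂ] H) →L[ℂ] (H →L[ℂ] H)}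
    (hone : Δ 1 = 0) (htr : ∀ A, tr (Δ A) = 0) :
    ((Module.finrank ℂ H : ℂ) ^ 2 - 1) * ∫ u, opTrace _ (unitaryConj H u⁻¹ * Δ) ∂μ = 0 := by
  rcases subsingleton_or_nontrivial H with hH | hH
  · simp [Subsingleton.elim Δ 0]
  have h := smul_integral_opTrace_smul_unitaryConj μ hone htr 1
  simp only [unitaryConj_one] at h
  rw [integral_smul_const, hone, smul_smul] at h
  exact (smul_eq_zero_iff_left one_ne_zero).1 h

end Reproducing

section MixedUnitary

variable {X Y : Type*} [NormedAddCommGroup X] [InnerProductSpace ℂ X] [CompleteSpace X]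
  [NormedAddCommGroup Y] [InnerProductSpace ℂ Y] [CompleteSpace Y]

/-- The channel `A ↦ U A U⋆` of a unitary operator `U` from `X` to `Y`. -/
noncomputable def unitaryChannel (U : X ≃ₗᵢ[ℂ] Y) : SuperOp X Y :=
  U.conjStarAlgEquiv.toAlgEquiv.toLinearMap

theorem unitaryChannel_apply (U : X ≃ₗᵢ[ℂ] Y) (A : X →L[ℂ] X) : unitaryChannel U A =
    (U : X →L[ℂ] Y) ∘L A ∘L ContinuousLinearMap.adjoint (U : X →L[ℂ] Y) := by
  rw [U.adjoint_eq_symm]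
  exact U.conjStarAlgEquiv_apply A

theorem doublyStochastic_unitaryChannel (U : X ≃ₗᵢ[ℂ] Y) : DoublyStochastic (unitaryChannel U) :=
  ⟨⟨CompletelyPositiveMapClass.toCompletelyPositiveLinearMap U.conjStarAlgEquiv, rfl⟩,
    fun A => LinearMap.trace_conj' (A : X →ₗ[ℂ] X) U.toLinearEquiv, map_one U.conjStarAlgEquiv⟩

theorem mixedUnitary_iff_mem_convexHull {Φ : SuperOp X Y} :
    MixedUnitary Φ ↔ Φ ∈ convexHull ℝ (range (unitaryChannel (X := X) (Y := Y))) := by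
  constructor
  · rintro ⟨N, U, p, hp, hp1, hΦ⟩
    refine mem_convexHull_of_exists_fintype p (fun i => unitaryChannel (U i)) hp hp1
      (fun i => mem_range_self _) (LinearMap.ext fun A => ?_)
    simp [hΦ, unitaryChannel_apply]
  · intro h
    obtain ⟨ι, _, p, z, hp, hp1, hz, rfl⟩ := mem_convexHull_iff_exists_fintype.1 h
    choose U hU using hz
    let e := (Fintype.equivFin ι).symm
    refine ⟨_, U ∘ e, p ∘ e, fun i => hp _, (e.sum_comp p).trans hp1, fun A => ?_⟩
    simp only [Function.comp_apply, ← unitaryChannel_apply, hU]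
    rw [e.sum_comp fun i => (p i : ℂ) • z i A]
    simp

/-- The density, with respect to the Haar measure, of a representation of `Φ` as an average of
unitary channels: `1 + (d² - 1) Tr (Ad_U⁻¹ ∘ (Φ - Ω))`, where `Ad_U` is the channel of `U`. -/
noncomputable def unitaryWeight (Φ : SuperOp X Y) (U : X ≃ₗᵢ[ℂ] Y) : ℂ :=
  1 + ((Module.finrank ℂ X : ℂ) ^ 2 - 1) *
    LinearMap.trace ℂ (X →L[ℂ] X) (unitaryChannel U.symm ∘ₗ (Φ - depolarizing X Y))

section Integral

variable {H : Type*} [NormedAddCommGroup H] [InnerProductSpace ℂ H] [CompleteSpace H]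

theorem unitaryChannel_linearIsometryEquiv (u : unitary (H →L[ℂ] H)) :
    unitaryChannel (Unitary.linearIsometryEquiv u) = (unitaryConj H u).toLinearMap :=
  rfl

variable [FiniteDimensional ℂ H]

theorem unitaryWeight_linearIsometryEquiv (Φ : SuperOp H H) (u : unitary (H →L[ℂ] H)) :
    unitaryWeight Φ (Unitary.linearIsometryEquiv u) = 1 + ((Module.finrank ℂ H : ℂ) ^ 2 - 1) *
      opTrace _ (unitaryConj H u⁻¹ * LinearMap.toContinuousLinearMap (Φ - depolarizing H H)) := by
  have hsymm : (Unitary.linearIsometryEquiv u).symm = Unitary.linearIsometryEquiv u⁻¹ :=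
    (map_inv Unitary.linearIsometryEquiv u).symm
  rw [unitaryWeight, hsymm, unitaryChannel_linearIsometryEquiv]
  rfl

theorem continuous_unitaryWeight (Φ : SuperOp H H) :
    Continuous fun u => unitaryWeight Φ (Unitary.linearIsometryEquiv u) := by
  have := continuous_unitaryConj (H := H)
  simp only [unitaryWeight_linearIsometryEquiv]
  fun_prop

variable [MeasurableSpace (unitary (H →L[ℂ] H))]
  [BorelSpace (unitary (H →L[ℂ] H))] (μ : Measure (unitary (H →L[ℂ] H))) [IsProbabilityMeasure μ]
  [μ.IsMulLeftInvariant]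

theorem integral_unitaryWeight {Φ : SuperOp H H} (htr : TracePreserving Φ) (hone : Unital Φ) :
    ∫ u, unitaryWeight Φ (Unitary.linearIsometryEquiv u) ∂μ = 1 := by
  have := continuous_unitaryConj (H := H)
  simp only [unitaryWeight_linearIsometryEquiv]
  rw [integral_add (integrable_const 1) (integrable_of_continuous (by fun_prop) μ),
    integral_const_mul,
    smul_integral_opTrace_unitaryConj μ (sub_depolarizing_one rfl hone)
      (tr_sub_depolarizing rfl htr)]
  simp

theorem integral_unitaryWeight_smul {Φ : SuperOp H H} (htr : TracePreserving Φ) (hone : Unital Φ)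
    (A : H →L[ℂ] H) :
    ∫ u, unitaryWeight Φ (Unitary.linearIsometryEquiv u) • unitaryConj H u A ∂μ = Φ A := by
  have := continuous_unitaryConj (H := H)
  have hmean : ∫ u, unitaryConj H u A ∂μ = depolarizing H H A :=
    twirl_unitary_eq_depolarizing μ A
  simp only [unitaryWeight_linearIsometryEquiv, add_smul, one_smul, mul_smul]
  rw [integral_add (integrable_of_continuous (by fun_prop) μ)
      (integrable_of_continuous (by fun_prop) μ), integral_smul, hmean,
    smul_integral_opTrace_smul_unitaryConj μ (sub_depolarizing_one rfl hone)
      (tr_sub_depolarizing rfl htr)]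
  exact add_sub_cancel _ _

end Integral

section Decomposition

variable {H : Type*} [NormedAddCommGroup H] [InnerProductSpace ℂ H] [CompleteSpace H]
  [FiniteDimensional ℂ H]

open scoped ComplexOrder in
theorem mem_convexHull_range_unitaryChannel {Φ : SuperOp H H} (htr : TracePreserving Φ)
    (hone : Unital Φ) (hΦ : ∀ U : H ≃ₗᵢ[ℂ] H, 0 ≤ unitaryWeight Φ U) :
    Φ ∈ convexHull ℝ (range (unitaryChannel (X := H) (Y := H))) := by
  borelize ↥(unitary (H →L[ℂ] H))
  let μ : Measure (unitary (H →L[ℂ] H)) := Measure.haarMeasure ⊤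
  have : IsProbabilityMeasure μ := ⟨Measure.haarMeasure_self⟩
  let w : unitary (H →L[ℂ] H) → ℝ := fun u =>
    (unitaryWeight Φ (Unitary.linearIsometryEquiv u)).re
  have hw : ∀ u, (w u : ℂ) = unitaryWeight Φ (Unitary.linearIsometryEquiv u) := fun u =>
    Complex.ext rfl (Complex.nonneg_iff.1 (hΦ _)).2
  have hcont : Continuous w := Complex.continuous_re.comp (continuous_unitaryWeight Φ)
  have hmass : ∫ u, w u ∂μ = 1 := by
    have h := integral_unitaryWeight μ htr hone
    simp only [← hw] at h
    rw [integral_complex_ofReal] at h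
    exact_mod_cast h
  have hint : Integrable (fun u => w u • unitaryConj H u) μ :=
    integrable_of_continuous (hcont.smul continuous_unitaryConj) μ
  have hmean : LinearMap.toContinuousLinearMap Φ = ∫ u, w u • unitaryConj H u ∂μ := by
    ext1 A
    rw [ContinuousLinearMap.integral_apply hint]
    refine (integral_unitaryWeight_smul μ htr hone A).symm.trans ?_
    simp only [← hw]
    rfl
  have hmem := integral_smul_mem_convexHull_range μ continuous_unitaryConj hcont
    (fun u => (Complex.nonneg_iff.1 (hΦ _)).1) hmass
  rw [← hmean] at hmem
  have himage := mem_image_of_mem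
    ((ContinuousLinearMap.coeLM ℂ (M := H →L[ℂ] H) (N₃ := H →L[ℂ] H)).restrictScalars ℝ) hmem
  rw [LinearMap.image_convexHull, ← range_comp] at himage
  refine convexHull_mono ?_ himage
  rintro _ ⟨u, rfl⟩
  exact ⟨Unitary.linearIsometryEquiv u, rfl⟩

theorem unitaryChannel_trans {Z : Type*} [NormedAddCommGroup Z] [InnerProductSpace ℂ Z]
    [CompleteSpace Z] (U : X ≃ₗᵢ[ℂ] Y) (V : Y ≃ₗᵢ[ℂ] Z) :
    unitaryChannel (U.trans V) = unitaryChannel V ∘ₗ unitaryChannel U :=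
  rfl

theorem unitaryChannel_comp_unitaryChannel_symm (U : X ≃ₗᵢ[ℂ] Y) :
    unitaryChannel U ∘ₗ unitaryChannel U.symm = LinearMap.id := by
  rw [← unitaryChannel_trans, U.symm_trans_self]
  rfl

theorem unitaryChannel_comp_depolarizing {Z : Type*} [NormedAddCommGroup Z] [InnerProductSpace ℂ Z]
    (U : X ≃ₗᵢ[ℂ] Y) : unitaryChannel U ∘ₗ depolarizing Z X = depolarizing Z Y :=
  LinearMap.ext fun A => by
    rw [LinearMap.comp_apply, depolarizing_apply, map_smul,
      (doublyStochastic_unitaryChannel U).2.2, depolarizing_apply]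

theorem unitaryWeight_unitaryChannel_symm_comp (V : X ≃ₗᵢ[ℂ] Y) (Φ : SuperOp X Y)
    (U : X ≃ₗᵢ[ℂ] X) :
    unitaryWeight (unitaryChannel V.symm ∘ₗ Φ) U = unitaryWeight Φ (U.trans V) := by
  rw [unitaryWeight, unitaryWeight, ← unitaryChannel_comp_depolarizing V.symm, ← LinearMap.comp_sub,
    ← LinearMap.comp_assoc, ← unitaryChannel_trans]
  rfl

open scoped ComplexOrder in
theorem mixedUnitary_of_unitaryWeight_nonneg [FiniteDimensional ℂ X] [FiniteDimensional ℂ Y]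
    (h : Module.finrank ℂ X = Module.finrank ℂ Y) {Φ : SuperOp X Y} (htr : TracePreserving Φ)
    (hone : Unital Φ) (hΦ : ∀ U, 0 ≤ unitaryWeight Φ U) : MixedUnitary Φ := by
  let V : X ≃ₗᵢ[ℂ] Y := (stdOrthonormalBasis ℂ X).equiv (stdOrthonormalBasis ℂ Y) (finCongr h)
  obtain ⟨-, hVtr, hVone⟩ := doublyStochastic_unitaryChannel V.symm
  have hmem : unitaryChannel V.symm ∘ₗ Φ ∈ convexHull ℝ (range unitaryChannel) :=
    mem_convexHull_range_unitaryChannel (fun A => (hVtr _).trans (htr A))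
      ((congrArg _ hone).trans hVone) fun U => by
        rw [unitaryWeight_unitaryChannel_symm_comp]
        exact hΦ _
  have himage := mem_image_of_mem
    ((LinearMap.compRight ℂ (M := X →L[ℂ] X) (unitaryChannel V)).restrictScalars ℝ) hmem
  rw [LinearMap.image_convexHull, ← range_comp] at himage
  have hΦV : unitaryChannel V ∘ₗ unitaryChannel V.symm ∘ₗ Φ = Φ := by
    rw [← LinearMap.comp_assoc, unitaryChannel_comp_unitaryChannel_symm, LinearMap.id_comp]
  rw [mixedUnitary_iff_mem_convexHull, ← hΦV]
  refine convexHull_mono ?_ himage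
  rintro _ ⟨U, rfl⟩
  exact ⟨U.trans V, unitaryChannel_trans U V⟩

end Decomposition

end MixedUnitary

section Choi

variable {X Y : Type*} [NormedAddCommGroup X] [InnerProductSpace ℂ X] [NormedAddCommGroup Y]
  [InnerProductSpace ℂ Y] {d : ℕ} (b : OrthonormalBasis (Fin d) ℂ X)

theorem choi_sub (Φ Ψ : SuperOp X Y) : choi b (Φ - Ψ) = choi b Φ - choi b Ψ :=
  ContinuousLinearMap.coe_injective <| TensorProduct.ext' fun y x => by
    simp [choi, TensorProduct.sub_tmul, smul_sub, Finset.sum_sub_distrib]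

theorem choi_depolarizing :
    choi b (depolarizing X Y) = (1 / (d : ℂ)) • (1 : (Y ⊗[ℂ] X) →L[ℂ] (Y ⊗[ℂ] X)) := by
  have : FiniteDimensional ℂ X := b.toBasis.finiteDimensional_of_finite
  have hd : Module.finrank ℂ X = d := by simpa using Module.finrank_eq_card_basis b.toBasis
  have hunit : ∀ i j, depolarizing X Y (rankOne ℂ (b i) (b j)) =
      if i = j then (1 / (d : ℂ)) • (1 : Y →L[ℂ] Y) else 0 := fun i j => by
    rw [depolarizing_apply, tr_eq_opTrace, opTrace_rankOne, hd, b.inner_eq_ite]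
    rcases eq_or_ne i j with rfl | hij
    · simp
    · simp [hij, hij.symm]
  refine ContinuousLinearMap.coe_injective (TensorProduct.ext' fun y x => ?_)
  simp only [choi, hunit, ContinuousLinearMap.coe_coe, sum_apply, TensorProduct.mapL_tmul]
  conv_rhs => rw [← b.sum_repr' x]
  simp [ite_apply, TensorProduct.ite_tmul, TensorProduct.tmul_sum, TensorProduct.smul_tmul',
    apply_ite, smul_comm (d : ℂ)⁻¹]

theorem isSymmetric_choi_depolarizing :
    (choi b (depolarizing X Y) : Y ⊗[ℂ] X →ₗ[ℂ] Y ⊗[ℂ] X).IsSymmetric := by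
  rw [choi_depolarizing, ContinuousLinearMap.toLinearMap_smul]
  exact LinearMap.IsSymmetric.id.smul (by simp)

/-- The maximally entangled vector `∑ i, U |i⟩ ⊗ |i⟩` of a unitary operator `U`, not normalized. -/
noncomputable def entangledVector (U : X ≃ₗᵢ[ℂ] Y) : Y ⊗[ℂ] X :=
  ∑ i, U (b i) ⊗ₜ[ℂ] b i

theorem norm_sq_entangledVector (U : X ≃ₗᵢ[ℂ] Y) : ‖entangledVector b U‖ ^ 2 = d := by
  have h : inner ℂ (entangledVector b U) (entangledVector b U) = (d : ℂ) := by
    simp [entangledVector, sum_inner, inner_sum, TensorProduct.inner_tmul, b.inner_eq_ite]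
  rw [@norm_sq_eq_re_inner ℂ, h]
  simp

theorem abs_re_inner_entangledVector_le (J : (Y ⊗[ℂ] X) →L[ℂ] (Y ⊗[ℂ] X)) (U : X ≃ₗᵢ[ℂ] Y) :
    |RCLike.re (inner ℂ (entangledVector b U) (J (entangledVector b U)))| ≤ d * ‖J‖ := by
  set v := entangledVector b U
  calc |RCLike.re (inner ℂ v (J v))|
    _ ≤ ‖inner ℂ v (J v)‖ := RCLike.abs_re_le_norm _
    _ ≤ ‖v‖ * ‖J v‖ := norm_inner_le_norm (𝕜 := ℂ) v (J v)
    _ ≤ ‖v‖ * (‖J‖ * ‖v‖) := by gcongr; exact J.le_opNorm v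
    _ = d * ‖J‖ := by rw [← norm_sq_entangledVector b U]; ring

theorem choi_entangledVector (Φ : SuperOp X Y) (U : X ≃ₗᵢ[ℂ] Y) :
    choi b Φ (entangledVector b U) =
      ∑ i, ∑ j, Φ (rankOne ℂ (b i) (b j)) (U (b j)) ⊗ₜ[ℂ] b i := by
  refine Eq.trans ?_ Finset.sum_comm
  simp [choi, entangledVector, b.inner_eq_ite, TensorProduct.tmul_ite]

theorem trace_superOp (R : SuperOp X X) : LinearMap.trace ℂ (X →L[ℂ] X) R =
    ∑ i, ∑ j, inner ℂ (b i) (R (rankOne ℂ (b i) (b j)) (b j)) := by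
  have : FiniteDimensional ℂ X := b.toBasis.finiteDimensional_of_finite
  have hexpand : ∀ A : X →L[ℂ] X, ∑ ij : Fin d × Fin d,
      inner ℂ (b ij.1) (A (b ij.2)) • (rankOne ℂ (b ij.1) (b ij.2) : X →L[ℂ] X) = A := fun A => by
    conv_rhs => rw [← sum_rankOne_apply_self b A]
    rw [Fintype.sum_prod_type_right]
    refine Finset.sum_congr rfl fun j _ => ?_
    conv_rhs => rw [← b.sum_repr' (A (b j))]
    simp
  rw [trace_eq_sum_of_sum_smul (l := fun ij : Fin d × Fin d =>
    (innerₛₗ ℂ (b ij.1)) ∘ₗ (ContinuousLinearMap.apply ℂ X (b ij.2)).toLinearMap) hexpand,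
    Fintype.sum_prod_type]
  rfl

variable [CompleteSpace X] [CompleteSpace Y]

theorem inner_choi_entangledVector (Φ : SuperOp X Y) (U : X ≃ₗᵢ[ℂ] Y) :
    inner ℂ (entangledVector b U) (choi b Φ (entangledVector b U)) =
      LinearMap.trace ℂ (X →L[ℂ] X) (unitaryChannel U.symm ∘ₗ Φ) := by
  have hconj : ∀ (A : Y →L[ℂ] Y) x z, inner ℂ x (unitaryChannel U.symm A z) =
      inner ℂ (U x) (A (U z)) := fun A x z => by
    rw [unitaryChannel, ← U.inner_map_map]
    simp
  rw [choi_entangledVector, trace_superOp b]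
  simp [hconj, entangledVector, sum_inner, inner_sum, TensorProduct.inner_tmul, b.inner_eq_ite]

theorem unitaryWeight_eq_inner_choi (Φ : SuperOp X Y) (U : X ≃ₗᵢ[ℂ] Y) :
    unitaryWeight Φ U = 1 + ((d : ℂ) ^ 2 - 1) * inner ℂ (entangledVector b U)
      ((choi b Φ - choi b (depolarizing X Y)) (entangledVector b U)) := by
  rw [← choi_sub, inner_choi_entangledVector, unitaryWeight, Module.finrank_eq_card_basis b.toBasis,
    Fintype.card_fin]

theorem natCast_mul_sq_sub_one_nonneg (n : ℕ) : 0 ≤ (n : ℝ) * ((n : ℝ) ^ 2 - 1) := by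
  rcases Nat.eq_zero_or_pos n with rfl | hn
  · simp
  · exact mul_nonneg n.cast_nonneg (sub_nonneg.2 (one_le_pow₀ (by exact_mod_cast hn)))

open scoped ComplexOrder in
theorem unitaryWeight_nonneg {Φ : SuperOp X Y}
    (hsymm : (choi b Φ : Y ⊗[ℂ] X →ₗ[ℂ] Y ⊗[ℂ] X).IsSymmetric)
    (hnorm : d * ((d : ℝ) ^ 2 - 1) * ‖choi b Φ - choi b (depolarizing X Y)‖ ≤ 1)
    (U : X ≃ₗᵢ[ℂ] Y) : 0 ≤ unitaryWeight Φ U := by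
  set J := choi b Φ - choi b (depolarizing X Y)
  set v := entangledVector b U
  have hJ : (J : Y ⊗[ℂ] X →ₗ[ℂ] Y ⊗[ℂ] X).IsSymmetric :=
    hsymm.sub (isSymmetric_choi_depolarizing b)
  have hreal : (RCLike.re (inner ℂ v (J v)) : ℂ) = inner ℂ v (J v) := hJ.coe_re_inner_self_apply v
  have hbound : |RCLike.re (inner ℂ v (J v))| ≤ d * ‖J‖ := abs_re_inner_entangledVector_le b J U
  have hweight : 0 ≤ 1 + ((d : ℝ) ^ 2 - 1) * RCLike.re (inner ℂ v (J v)) := by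
    rcases Nat.eq_zero_or_pos d with rfl | hd
    · have hre : RCLike.re (inner ℂ v (J v)) = 0 := by simpa using hbound
      rw [hre, mul_zero, add_zero]
      exact zero_le_one
    · have hd' : (0 : ℝ) ≤ (d : ℝ) ^ 2 - 1 := by
        rw [sub_nonneg]
        exact one_le_pow₀ (by exact_mod_cast hd)
      have hlower := mul_le_mul_of_nonneg_left (abs_le.1 hbound).1 hd'
      linarith
  rw [unitaryWeight_eq_inner_choi b, ← hreal]
  exact_mod_cast hweight

theorem mixedUnitary_of_norm_choi_sub_le [FiniteDimensional ℂ Y] (hd : Module.finrank ℂ Y = d)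
    {Φ : SuperOp X Y} (htr : TracePreserving Φ) (hone : Unital Φ)
    (hsymm : (choi b Φ : Y ⊗[ℂ] X →ₗ[ℂ] Y ⊗[ℂ] X).IsSymmetric)
    (hnorm : d * ((d : ℝ) ^ 2 - 1) * ‖choi b Φ - choi b (depolarizing X Y)‖ ≤ 1) :
    MixedUnitary Φ := by
  have : FiniteDimensional ℂ X := b.toBasis.finiteDimensional_of_finite
  have hX : Module.finrank ℂ X = d := by simpa using Module.finrank_eq_card_basis b.toBasis
  exact mixedUnitary_of_unitaryWeight_nonneg (hX.trans hd.symm) htr hone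
    (unitaryWeight_nonneg b hsymm hnorm)

theorem mixedUnitary_depolarizing [FiniteDimensional ℂ X] [FiniteDimensional ℂ Y]
    (h : Module.finrank ℂ X = Module.finrank ℂ Y) : MixedUnitary (depolarizing X Y) :=
  mixedUnitary_of_norm_choi_sub_le (stdOrthonormalBasis ℂ X) h.symm
    (tracePreserving_depolarizing h) (unital_depolarizing h) (isSymmetric_choi_depolarizing _)
    (by rw [sub_self, ContinuousLinearMap.opNorm_zero, mul_zero]; exact zero_le_one)

end Choi

section AffineSpan

variable {X Y : Type*} [NormedAddCommGroup X] [InnerProductSpace ℂ X] [CompleteSpace X]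
  [NormedAddCommGroup Y] [InnerProductSpace ℂ Y] [CompleteSpace Y]

theorem CompletelyPositive.map_star {Φ : SuperOp X Y} (h : CompletelyPositive Φ)
    (A : X →L[ℂ] X) : Φ (star A) = star (Φ A) := by
  obtain ⟨F, rfl⟩ := h
  exact StarHomClass.map_star F A

theorem isSymmetric_choi [FiniteDimensional ℂ Y] {d : ℕ} (b : OrthonormalBasis (Fin d) ℂ X)
    {Φ : SuperOp X Y} (h : ∀ A, Φ (star A) = star (Φ A)) :
    (choi b Φ : Y ⊗[ℂ] X →ₗ[ℂ] Y ⊗[ℂ] X).IsSymmetric := by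
  have : FiniteDimensional ℂ X := b.toBasis.finiteDimensional_of_finite
  have : CompleteSpace (Y ⊗[ℂ] X) := FiniteDimensional.complete ℂ _
  have hunit : ∀ i j, ContinuousLinearMap.adjoint (Φ (rankOne ℂ (b i) (b j))) =
      Φ (rankOne ℂ (b j) (b i)) := fun i j => by
    rw [← ContinuousLinearMap.star_eq_adjoint, ← h, ContinuousLinearMap.star_eq_adjoint,
      adjoint_rankOne]
  rw [← ContinuousLinearMap.isSelfAdjoint_iff_isSymmetric, isSelfAdjoint_iff]
  simp only [choi, star_sum, ContinuousLinearMap.star_eq_adjoint, TensorProduct.adjoint_mapL,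
    adjoint_rankOne, hunit]
  exact Finset.sum_comm

theorem tracePreserving_of_mem_affineSpan {Φ : SuperOp X Y}
    (h : Φ ∈ affineSpan ℝ {Ψ : SuperOp X Y | DoublyStochastic Ψ}) : TracePreserving Φ :=
  affineSpan_induction h (fun _ hΨ => hΨ.2.1) fun r Ψ₁ Ψ₂ Ψ₃ h₁ h₂ h₃ A => by
    have htr : tr (r • (Ψ₁ A - Ψ₂ A) + Ψ₃ A) = r • (tr (Ψ₁ A) - tr (Ψ₂ A)) + tr (Ψ₃ A) := by
      simp [tr]
    exact htr.trans (by rw [h₁, h₂, h₃, sub_self, smul_zero, zero_add])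

theorem unital_of_mem_affineSpan {Φ : SuperOp X Y}
    (h : Φ ∈ affineSpan ℝ {Ψ : SuperOp X Y | DoublyStochastic Ψ}) : Unital Φ :=
  affineSpan_induction h (fun _ hΨ => hΨ.2.2) fun r Ψ₁ Ψ₂ Ψ₃ h₁ h₂ h₃ =>
    show r • (Ψ₁ 1 - Ψ₂ 1) + Ψ₃ 1 = 1 by
      rw [h₁, h₂, h₃, sub_self, smul_zero, zero_add]

theorem map_star_of_mem_affineSpan {Φ : SuperOp X Y}
    (h : Φ ∈ affineSpan ℝ {Ψ : SuperOp X Y | DoublyStochastic Ψ}) (A : X →L[ℂ] X) :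
    Φ (star A) = star (Φ A) :=
  affineSpan_induction (p := fun Ψ : SuperOp X Y => Ψ (star A) = star (Ψ A)) h
    (fun _ hΨ => hΨ.1.map_star A) fun r Ψ₁ Ψ₂ Ψ₃ h₁ h₂ h₃ => by simp [h₁, h₂, h₃]

theorem MixedUnitary.mem_affineSpan {Φ : SuperOp X Y} (h : MixedUnitary Φ) :
    Φ ∈ affineSpan ℝ {Ψ : SuperOp X Y | DoublyStochastic Ψ} :=
  convexHull_subset_affineSpan _ <| convexHull_mono
    (range_subset_iff.2 doublyStochastic_unitaryChannel) (mixedUnitary_iff_mem_convexHull.1 h)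

end AffineSpan

end QChannel

theorem mainTheorem2 {X Y : Type*}
    [NormedAddCommGroup X] [InnerProductSpace ℂ X] [CompleteSpace X]
    [NormedAddCommGroup Y] [InnerProductSpace ℂ Y] [CompleteSpace Y] [FiniteDimensional ℂ Y]
    (d : ℕ) (b : OrthonormalBasis (Fin d) ℂ X) (hY : Module.finrank ℂ Y = d) :
    (∀ Φ : QChannel.SuperOp X Y,
      QChannel.TracePreserving Φ → QChannel.Unital Φ →
      (QChannel.choi b Φ : Y ⊗[ℂ] X →ₗ[ℂ] Y ⊗[ℂ] X).IsSymmetric →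
      ‖QChannel.choi b Φ - (1 / (d : ℂ)) • (1 : (Y ⊗[ℂ] X) →L[ℂ] (Y ⊗[ℂ] X))‖
        ≤ 1 / ((d : ℝ) * ((d : ℝ) ^ 2 - 1)) →
      QChannel.MixedUnitary Φ) ∧
    (QChannel.depolarizing X Y ∈
        affineSpan ℝ {Ψ : QChannel.SuperOp X Y | QChannel.DoublyStochastic Ψ} ∧
      ∃ r : ℝ, 0 < r ∧
        ∀ Φ ∈ affineSpan ℝ {Ψ : QChannel.SuperOp X Y | QChannel.DoublyStochastic Ψ},
          ‖QChannel.choi b Φ - QChannel.choi b (QChannel.depolarizing X Y)‖ ≤ r →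
          QChannel.MixedUnitary Φ) := by
  have : FiniteDimensional ℂ X := b.toBasis.finiteDimensional_of_finite
  have hX : Module.finrank ℂ X = d := by simpa using Module.finrank_eq_card_basis b.toBasis
  have hd := QChannel.natCast_mul_sq_sub_one_nonneg d
  refine ⟨fun Φ htr hone hsymm hnorm => ?_,
    (QChannel.mixedUnitary_depolarizing (hX.trans hY.symm)).mem_affineSpan,
    1 / (d * ((d : ℝ) ^ 2 - 1) + 1), by positivity, fun Φ hΦ hnorm => ?_⟩
  · rw [← QChannel.choi_depolarizing b] at hnorm
    exact QChannel.mixedUnitary_of_norm_choi_sub_le b hY htr hone hsymm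
      ((mul_comm _ _).trans_le (mul_le_of_le_div₀ zero_le_one hd hnorm))
  · refine QChannel.mixedUnitary_of_norm_choi_sub_le b hY
      (QChannel.tracePreserving_of_mem_affineSpan hΦ) (QChannel.unital_of_mem_affineSpan hΦ)
      (QChannel.isSymmetric_choi b (QChannel.map_star_of_mem_affineSpan hΦ)) ?_
    have hle := mul_le_of_le_div₀ zero_le_one (add_nonneg hd zero_le_one) hnorm
    linarith [(QChannel.choi b Φ - QChannel.choi b (QChannel.depolarizing X Y)).opNorm_nonneg]
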